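/- Let $d\ge 1$ and $s$ be natural numbers with $s>d/2$. Call a matrix $B\in\mathbb{R}^{d\times d}$ a Frolov matrix if (a) $B$ is invertible; (b) $\bigl|\prod_{j=1}^d (Bm)_j\bigr|\ge 1$ for all $m\in\mathbb{Z}^d\setminus\{0\}$; (c) for all $x,y\in\mathbb{R}^d$ the box $\{z\in\mathbb{R}^d : z_j \text{ lies between } x_j \text{ and } y_j \text{ for } j=1,\dots,d\}$ contains at most $\prod_{j=1}^d|x_j-y_j|+1$ lattice points $Bm$, $m\in\mathbb{Z}^d$. For an invertible matrix $S\in\mathbb{R}^{d\times d}$, a shift parameter $v\in\mathbb{R}^d$ and a compactly supported $f:\mathbb{R}^d\to\mathbb{R}$ let $$Q_S^v(f)=\frac{1}{|\det S|}\sum_{m\in\mathbb{Z}^d} f\bigl(S^{-\top}(m+v)\bigr),\qquad I_d(f)=\int_{\mathbb{R}^d} f(x)\,dx .$$ Let $\mathring H^s([0,1]^d)$ be the space of all continuous functions $f:\mathbb{R}^d\to\mathbb{R}$ with support in $[0,1]^d$ such that $f$ and all its weak derivatives $D^\alpha f$, $|\alpha|\le s$, belong to $L^2(\mathbb{R}^d)$,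 and let $$\|f\|_{H^s([0,1]^d)}=\Bigl(\sum_{|\alpha|\le s}\|D^\alpha f\|_{L^2([0,1]^d)}^2\Bigr)^{1/2},$$ where $\alpha\in\mathbb{N}_0^d$ and $|\alpha|=\alpha_1+\dots+\alpha_d$. For $u\in\mathbb{R}^d$ write $\hat u=\operatorname{diag}(u_1,\dots,u_d)$. Theorem. Let $B\in\mathbb{R}^{d\times d}$ be a Frolov matrix. There is a constant $c>0$ (depending only on $d$, $s$ and $B$) such that for every shift parameter $v\in\mathbb{R}^d$, every integer $n\ge 1$ and every $f\in\mathring H^s([0,1]^d)$, $$\sup_{u\in[1,2^{1/d}]^d}\bigl|Q^v_{n^{1/d}\hat uB}(f)-I_d(f)\bigr|\le c\,n^{-s/d}\,\|f\|_{H^s([0,1]^d)} .$$ -/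

import Mathlib

open MeasureTheory
open scoped ContDiff

noncomputable section

/-- The length `|α| = ∑ⱼ αⱼ` of a multi-index. -/
def multiLength {d : ℕ} (α : Fin d → ℕ) : ℕ := ∑ j, α j

/-- The finite set of all multi-indices `α ∈ ℕ₀^d` with `|α| ≤ s`. -/
def multiIndices (d s : ℕ) : Finset (Fin d → ℕ) :=
  (Fintype.piFinset fun _ : Fin d => Finset.range (s + 1)).filter fun α => multiLength α ≤ s

theorem mem_multiIndices {d s : ℕ} (α : Fin d → ℕ) :
    α ∈ multiIndices d s ↔ multiLength α ≤ s := by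
  simp only [multiIndices, Finset.mem_filter, Fintype.mem_piFinset, Finset.mem_range,
    and_iff_right_iff_imp]
  intro h j
  have h1 : α j ≤ multiLength α :=
    Finset.single_le_sum (f := α) (fun i _ => Nat.zero_le (α i)) (Finset.mem_univ j)
  omega

/-- The classical partial derivative `∂φ/∂xⱼ`. -/
def partialDeriv {d : ℕ} (j : Fin d) (φ : (Fin d → ℝ) → ℝ) : (Fin d → ℝ) → ℝ :=
  fun x => fderiv ℝ φ x (Pi.single j 1)

/-- The classical iterated partial derivative `∂^α φ = ∂₁^{α₁} ⋯ ∂_d^{α_d} φ`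
(applied only to smooth `φ`, so that the order of differentiation is immaterial). -/
def multiDeriv {d : ℕ} (α : Fin d → ℕ) (φ : (Fin d → ℝ) → ℝ) : (Fin d → ℝ) → ℝ :=
  (List.finRange d).foldr (fun j ψ => (partialDeriv j)^[α j] ψ) φ

/-- `g` is a weak derivative `D^α f` on the open set `Ω ⊆ ℝ^d`:
`∫_Ω f ∂^α φ = (-1)^{|α|} ∫_Ω g φ` for every test function `φ ∈ C_c^∞(Ω)`. -/
structure HasWeakDeriv {d : ℕ} (Ω : Set (Fin d → ℝ)) (α : Fin d → ℕ)
    (f g : (Fin d → ℝ) → ℝ) : Prop where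
  locallyIntegrable : LocallyIntegrableOn f Ω volume
  locallyIntegrable_deriv : LocallyIntegrableOn g Ω volume
  integral_eq : ∀ φ : (Fin d → ℝ) → ℝ, ContDiff ℝ ∞ φ → HasCompactSupport φ → tsupport φ ⊆ Ω →
    ∫ x in Ω, f x * multiDeriv α φ x = (-1 : ℝ) ^ multiLength α * ∫ x in Ω, g x * φ x

/-- `f ∈ L²(Ω)`, and for every `|α| ≤ s` the weak derivative `D^α f` exists and lies in `L²(Ω)`. -/
def MemSobolev {d : ℕ} (Ω : Set (Fin d → ℝ)) (s : ℕ) (f : (Fin d → ℝ) → ℝ) : Prop :=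
  MemLp f 2 (volume.restrict Ω) ∧
    ∀ α : Fin d → ℕ, multiLength α ≤ s →
      ∃ g : (Fin d → ℝ) → ℝ, MemLp g 2 (volume.restrict Ω) ∧ HasWeakDeriv Ω α f g

open Classical in
/-- The weak derivative `D^α f ∈ L²(Ω)`, unique up to null sets
(and `0` if there is no square-integrable weak derivative). -/
def weakDeriv {d : ℕ} (Ω : Set (Fin d → ℝ)) (α : Fin d → ℕ) (f : (Fin d → ℝ) → ℝ) :
    (Fin d → ℝ) → ℝ :=
  if h : ∃ g : (Fin d → ℝ) → ℝ, MemLp g 2 (volume.restrict Ω) ∧ HasWeakDeriv Ω α f g then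
    Classical.choose h
  else 0

/-- The Sobolev norm `‖f‖_{H^s(Ω)} = (∑_{|α| ≤ s} ‖D^α f‖²_{L²(Ω)})^{1/2}`. -/
def sobolevNorm {d : ℕ} (Ω : Set (Fin d → ℝ)) (s : ℕ) (f : (Fin d → ℝ) → ℝ) : ℝ :=
  Real.sqrt (∑ α ∈ multiIndices d s, ∫ x in Ω, (weakDeriv Ω α f x) ^ 2)

/-- The open unit cube `(0,1)^d`. It differs from `[0,1]^d` by a null set, so that
`L²((0,1)^d) = L²([0,1]^d)` and `H^s([0,1]^d)` is the Sobolev space on this open set. -/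
def openUnitCube (d : ℕ) : Set (Fin d → ℝ) := Set.univ.pi fun _ => Set.Ioo (0 : ℝ) 1

/-- The norm of `H^s([0,1]^d)`. -/
def isoNormUnit {d : ℕ} (s : ℕ) (f : (Fin d → ℝ) → ℝ) : ℝ := sobolevNorm (openUnitCube d) s f

/-- `f ∈ H̊^s([0,1]^d)`: the (continuous representative of the) function `f` belongs to `H^s(ℝ^d)`
and has compact support in the unit cube `[0,1]^d`. -/
structure MemIsoSobolevZero {d : ℕ} (s : ℕ) (f : (Fin d → ℝ) → ℝ) : Prop where
  continuous : Continuous f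
  support_subset : tsupport f ⊆ Set.Icc (fun _ : Fin d => (0 : ℝ)) (fun _ => 1)
  memSobolev : MemSobolev Set.univ s f

/-- The vector in `ℝ^d` with the integer coordinates `m`. -/
def intVec {d : ℕ} (m : Fin d → ℤ) : Fin d → ℝ := fun j => (m j : ℝ)

/-- Frolov matrices. The box `[x,y]` is the set of all `z` whose `j`-th coordinate lies between
`xⱼ` and `yⱼ` for all `j`. -/
structure IsFrolovMatrix {d : ℕ} (B : Matrix (Fin d) (Fin d) ℝ) : Prop where
  invertible : IsUnit B.det
  one_le_abs_prod : ∀ m : Fin d → ℤ, m ≠ 0 → 1 ≤ |∏ j, B.mulVec (intVec m) j|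
  card_box : ∀ x y : Fin d → ℝ,
    {m : Fin d → ℤ | ∀ j, B.mulVec (intVec m) j ∈ Set.uIcc (x j) (y j)}.Finite ∧
    ({m : Fin d → ℤ | ∀ j, B.mulVec (intVec m) j ∈ Set.uIcc (x j) (y j)}.ncard : ℝ)
      ≤ (∏ j, |x j - y j|) + 1

/-- The quadrature rule `Q_S^v(f) = |det S|⁻¹ ∑_{m ∈ ℤ^d} f(S^{-⊤}(m + v))`.
The sum is finite if `S` is invertible and `f` has compact support. -/
def quadRule {d : ℕ} (S : Matrix (Fin d) (Fin d) ℝ) (v : Fin d → ℝ) (f : (Fin d → ℝ) → ℝ) : ℝ :=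
  1 / |S.det| * ∑' m : Fin d → ℤ, f ((S⁻¹).transpose.mulVec (intVec m + v))

/-- The matrix `n^{1/d} û B` with `û = diag(u₁, …, u_d)`. -/
def dilatedMatrix {d : ℕ} (n : ℕ) (u : Fin d → ℝ) (B : Matrix (Fin d) (Fin d) ℝ) :
    Matrix (Fin d) (Fin d) ℝ :=
  ((n : ℝ) ^ (1 / (d : ℝ))) • (Matrix.diagonal u * B)

/-- The box `[1, 2^{1/d}]^d` of dilation parameters. -/
def dilationBox (d : ℕ) : Set (Fin d → ℝ) :=
  Set.Icc (fun _ => (1 : ℝ)) (fun _ => (2 : ℝ) ^ (1 / (d : ℝ)))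

/-- The integration error `|Q^v_{n^{1/d} û B}(f) - I_d(f)|`. -/
def quadError {d : ℕ} (B : Matrix (Fin d) (Fin d) ℝ) (n : ℕ) (v : Fin d → ℝ)
    (f : (Fin d → ℝ) → ℝ) (u : Fin d → ℝ) : ℝ :=
  |quadRule (dilatedMatrix n u B) v f - ∫ x, f x|

end

/-! The error is a tail of a Fourier series. With nodes `S^{-⊤}(m+v)`, let `P` be the
`ℤ^d`-periodization of `y ↦ f(S^{-⊤}(y+v))`. Then `P 0 = |det S| Q_S^v(f)`, and the `k`-th Fourier
coefficient `a k` of `P` is, up to a phase, `|det S|` times the Fourier transform of `f` at `Sk`, so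
`a 0 = |det S| I_d(f)`. Hence the error is `|det S|⁻¹ |∑_{k≠0} a k|`.

Cauchy–Schwarz with weights `‖k‖^s` splits this sum. The factor `∑ ‖k‖^{-2s}` converges because `2s
> d`. For the other factor, the largest coordinate `j` of `Sk` satisfies `|(Sk)_j| ≥ κ‖k‖`, so
`(κ‖k‖)^s |a k|` is at most the `k`-th coefficient of the periodized `∂_j^s f`
(`MemIsoSobolevZero.abs_pow_mul_norm_integral_exp`). Parseval bounds the squares of those
coefficients by the `L²` norm times the number of overlapping translates
(`summable_tsum_sq_integral_latticeChar_le`, `exists_finset_card_le_of_nodeMap_mem`).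

For `S = n^{1/d} û B` the number of translates and `|det S|` both scale like `n`, so their ratio
stays bounded uniformly in `u`; `κ` scales like `n^{1/d}`, and `κ^{-s}` gives the rate `n^{-s/d}`.
-/

/-! ### Fourier series on the unit box, transferred from the torus. -/

section FourierOnUnitBox

open UnitAddTorus

-- Total mass one, the normalization under which the characters are orthonormal and the torus
-- integral equals the Lebesgue integral over the unit box.
noncomputable local instance : MeasureSpace UnitAddCircle := ⟨AddCircle.haarAddCircle⟩

/-- The half-open unit box `(0,1]^d`, a fundamental domain of `ℤ^d`. -/
def unitBox (d : ℕ) : Set (Fin d → ℝ) := {x | ∀ i, x i ∈ Set.Ioc (0 : ℝ) 1}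

/-- The character `y ↦ exp(2πi k·y)` of `ℝ^d`. -/
noncomputable def latticeChar {d : ℕ} (k : Fin d → ℤ) (y : Fin d → ℝ) : ℂ :=
  mFourier k (fun i => (y i : UnitAddCircle))

theorem measurableSet_unitBox (d : ℕ) : MeasurableSet (unitBox d) :=
  MeasurableSet.univ_pi' fun _ => measurableSet_Ioc

theorem latticeChar_eq_exp {d : ℕ} (k : Fin d → ℤ) (y : Fin d → ℝ) :
    latticeChar k y = Complex.exp ((2 * Real.pi * (intVec k ⬝ᵥ y) : ℝ) * Complex.I) := by
  simp only [latticeChar, mFourier, ContinuousMap.coe_mk, fourier_coe_apply, ← Complex.exp_sum,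
    dotProduct, intVec]
  congr 1
  push_cast
  rw [Finset.mul_sum, Finset.sum_mul]
  exact Finset.sum_congr rfl fun i _ => by ring

theorem continuous_latticeChar {d : ℕ} (k : Fin d → ℤ) : Continuous (latticeChar k) := by
  have : (latticeChar k) =
      fun y => Complex.exp ((2 * Real.pi * (intVec k ⬝ᵥ y) : ℝ) * Complex.I) :=
    funext (latticeChar_eq_exp k)
  rw [this]
  simp only [dotProduct]
  fun_prop

theorem norm_latticeChar {d : ℕ} (k : Fin d → ℤ) (y : Fin d → ℝ) : ‖latticeChar k y‖ = 1 := by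
  rw [latticeChar_eq_exp, Complex.norm_exp_ofReal_mul_I]

theorem latticeChar_add_intVec {d : ℕ} (k m : Fin d → ℤ) (y : Fin d → ℝ) :
    latticeChar k (y + intVec m) = latticeChar k y := by
  have h : (fun i => (((y + intVec m) i : ℝ) : UnitAddCircle)) = fun i => (y i : UnitAddCircle) := by
    funext i
    simp [intVec]
  simp only [latticeChar, h]

theorem latticeChar_at_zero {d : ℕ} (k : Fin d → ℤ) : latticeChar k 0 = 1 := by
  simp [latticeChar_eq_exp]

theorem latticeChar_zero {d : ℕ} (y : Fin d → ℝ) : latticeChar 0 y = 1 := by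
  simp [latticeChar, mFourier_zero]

/-- The `ℤ^d`-periodic extension from the unit box, as a function on the torus. -/
noncomputable def torusLift {d : ℕ} (Q : (Fin d → ℝ) → ℂ) (t : UnitAddTorus (Fin d)) : ℂ :=
  Q (fun i => (AddCircle.equivIoc 1 0 (t i)).1)

theorem torusLift_coe {d : ℕ} (Q : (Fin d → ℝ) → ℂ) {y : Fin d → ℝ} (hy : y ∈ unitBox d) :
    torusLift Q (fun i => (y i : UnitAddCircle)) = Q y := by
  unfold torusLift
  congr 1
  funext i
  have h : y i ∈ Set.Ioc (0 : ℝ) (0 + 1) := by simpa using hy i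
  exact AddCircle.equivIoc_coe_of_mem h

theorem unitBox_eq (d : ℕ) :
    {x : Fin d → ℝ | ∀ i, x i ∈ Set.Ioc ((0 : Fin d → ℝ) i) ((0 : Fin d → ℝ) i + 1)} = unitBox d := by
  simp [unitBox]

theorem mFourierCoeff_torusLift {d : ℕ} (Q : (Fin d → ℝ) → ℂ) (k : Fin d → ℤ) :
    mFourierCoeff (torusLift Q) k = ∫ y in unitBox d, latticeChar (-k) y * Q y := by
  rw [mFourierCoeff_eq_integral _ _ 0, unitBox_eq]
  refine setIntegral_congr_fun (measurableSet_unitBox d) fun y hy => ?_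
  simp only [torusLift_coe Q hy, latticeChar, smul_eq_mul]

theorem memLp_torusLift {d : ℕ} {Q : (Fin d → ℝ) → ℂ}
    (hQ : MemLp Q 2 (volume.restrict (unitBox d))) : MemLp (torusLift Q) 2 volume := by
  have h1 : MemLp (fun x : {x : Fin d → ℝ // ∀ i, x i ∈ Set.Ioc ((0 : Fin d → ℝ) i) ((0 : Fin d → ℝ) i + 1)} => Q x.1) 2 (Measure.comap Subtype.val volume) := by
    rw [← unitBox_eq] at hQ
    exact hQ.comp_measurePreserving (measurePreserving_subtype_coe
      (MeasurableSet.univ_pi' fun _ => measurableSet_Ioc))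
  exact h1.comp_measurePreserving (measurePreserving_equivPiIoc 0)

/-- **Parseval's identity** on the unit box. -/
theorem hasSum_sq_integral_latticeChar {d : ℕ} {Q : (Fin d → ℝ) → ℂ}
    (hQ : MemLp Q 2 (volume.restrict (unitBox d))) :
    HasSum (fun k : Fin d → ℤ => ‖∫ y in unitBox d, latticeChar (-k) y * Q y‖ ^ 2)
      (∫ y in unitBox d, ‖Q y‖ ^ 2) := by
  have h := hasSum_sq_mFourierCoeff ((memLp_torusLift hQ).toLp _)
  have hae := (memLp_torusLift hQ).coeFn_toLp
  have h1 : ∀ k, mFourierCoeff (((memLp_torusLift hQ).toLp _)) k = ∫ y in unitBox d, latticeChar (-k) y * Q y := by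
    intro k
    rw [← mFourierCoeff_torusLift]
    refine integral_congr_ae ?_
    filter_upwards [hae] with t ht
    rw [ht]
  have h2 : ∫ t, ‖(memLp_torusLift hQ).toLp _ t‖ ^ 2 = ∫ y in unitBox d, ‖Q y‖ ^ 2 := by
    have : ∫ t, ‖(memLp_torusLift hQ).toLp _ t‖ ^ 2 = ∫ t, ‖torusLift Q t‖ ^ 2 := by
      refine integral_congr_ae ?_
      filter_upwards [hae] with t ht
      rw [ht]
    rw [this, integral_preimage _ 0, unitBox_eq]
    refine setIntegral_congr_fun (measurableSet_unitBox d) fun y hy => ?_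
    simp only [torusLift_coe Q hy]
  simp only [h1, h2] at h
  exact h

/-- The torus carries the quotient topology, and periodicity makes the lift composed with the
quotient map equal to `P`, so no discontinuity appears at the faces of the box. -/
theorem continuous_torusLift {d : ℕ} {P : (Fin d → ℝ) → ℂ} (hP : Continuous P)
    (hper : ∀ (m : Fin d → ℤ) y, P (y + intVec m) = P y) : Continuous (torusLift P) := by
  have hq : IsOpenQuotientMap (Pi.map fun (_ : Fin d) (x : ℝ) => (x : UnitAddCircle)) :=
    IsOpenQuotientMap.piMap fun _ => QuotientAddGroup.isOpenQuotientMap_mk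
  rw [hq.isQuotientMap.continuous_iff]
  have : torusLift P ∘ (Pi.map fun (_ : Fin d) (x : ℝ) => (x : UnitAddCircle)) = P := by
    funext y
    have h : ∀ i, ∃ m : ℤ, (AddCircle.equivIoc 1 0 (y i : UnitAddCircle)).1 = y i + m := by
      intro i
      have h2 : (((AddCircle.equivIoc 1 0 (y i : UnitAddCircle)).1 - y i : ℝ) : UnitAddCircle)
          = 0 := by
        rw [AddCircle.coe_sub, AddCircle.coe_equivIoc, sub_self]
      obtain ⟨m, hm⟩ := (AddCircle.coe_eq_zero_iff 1).1 h2
      refine ⟨m, ?_⟩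
      rw [zsmul_eq_mul, mul_one] at hm
      linarith
    choose m hm using h
    have h3 : (fun i => (AddCircle.equivIoc 1 0 (y i : UnitAddCircle)).1) = y + intVec m := by
      funext i
      simp [hm, intVec]
    change P (fun i => (AddCircle.equivIoc 1 0 (y i : UnitAddCircle)).1) = P y
    rw [h3, hper]
  rw [this]
  exact hP

/-- The Fourier series of a continuous periodic function with summable coefficients, at `0`. -/
theorem hasSum_integral_latticeChar {d : ℕ} {P : (Fin d → ℝ) → ℂ} (hP : Continuous P)
    (hper : ∀ (m : Fin d → ℤ) y, P (y + intVec m) = P y)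
    (hs : Summable fun k : Fin d → ℤ => ∫ y in unitBox d, latticeChar (-k) y * P y) :
    HasSum (fun k : Fin d → ℤ => ∫ y in unitBox d, latticeChar (-k) y * P y) (P 0) := by
  have hs' : Summable (mFourierCoeff (⟨torusLift P, continuous_torusLift hP hper⟩ :
      C(UnitAddTorus (Fin d), ℂ))) := by
    refine hs.congr fun k => ?_
    exact (mFourierCoeff_torusLift P k).symm
  have h := hasSum_mFourier_series_apply_of_summable hs' (fun _ => ((1 : ℝ) : UnitAddCircle))
  have h1 : torusLift P (fun _ => ((1 : ℝ) : UnitAddCircle)) = P 0 := by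
    -- The box is `(0,1]^d`, so the class of `0` is represented by `(1,…,1)`.
    rw [torusLift_coe (y := fun _ => 1) P (fun i => by simp), ← hper 1 0]
    congr 1
    funext i
    simp [intVec]
  have h2 : ∀ k : Fin d → ℤ, mFourier k (fun _ => ((1 : ℝ) : UnitAddCircle)) = 1 := by
    intro k
    rw [← latticeChar_at_zero k, ← latticeChar_add_intVec k 1]
    simp [latticeChar, intVec]
  simp only [ContinuousMap.coe_mk, h1, h2, smul_eq_mul, mul_one, mFourierCoeff_torusLift] at h
  exact h

end FourierOnUnitBox

/-- Unfolding: an integral over `ℝ^d` as an integral over the unit box of a periodization. -/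
theorem integral_eq_setIntegral_unitBox_sum {d : ℕ} {E : Type*} [NormedAddCommGroup E]
    [NormedSpace ℝ E] {H : (Fin d → ℝ) → E}
    (hH : Integrable H) (M : Finset (Fin d → ℤ))
    (hM : ∀ m, ∀ y ∈ unitBox d, H (y + intVec m) ≠ 0 → m ∈ M) :
    ∫ x, H x = ∫ y in unitBox d, ∑ m ∈ M, H (y + intVec m) := by
  have hT : ∀ m, MeasurableSet ((fun y => y + -intVec m) ⁻¹' unitBox d) := fun m =>
    (measurable_add_const _) (measurableSet_unitBox d)
  have hcover : ∀ x ∉ ⋃ m ∈ M, (fun y => y + -intVec m) ⁻¹' unitBox d, H x = 0 := by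
    intro x hx
    by_contra hne
    refine hx ?_
    -- The ceiling minus one, not the floor, because the box omits `0` and contains `1`.
    let m : Fin d → ℤ := fun i => ⌈x i⌉ - 1
    have hb : x + -intVec m ∈ unitBox d := by
      intro i
      have h1 := Int.ceil_lt_add_one (x i)
      have h2 := Int.le_ceil (x i)
      simp only [Pi.add_apply, Pi.neg_apply, intVec, m, Int.cast_sub, Int.cast_one, Set.mem_Ioc]
      constructor <;> linarith
    refine Set.mem_iUnion₂.2 ⟨m, hM m _ hb ?_, hb⟩
    simpa using hne
  rw [← setIntegral_eq_integral_of_forall_compl_eq_zero hcover,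
    integral_biUnion_finset M (fun m _ => hT m) ?_ (fun m _ => hH.integrableOn),
    integral_finsetSum]
  · refine Finset.sum_congr rfl fun m _ => ?_
    have := (measurePreserving_add_right volume (-intVec m)).setIntegral_preimage_emb
      (measurableEmbedding_addRight _) (fun y => H (y + intVec m)) (unitBox d)
    simpa using this
  · intro m _
    exact (hH.comp_add_right (intVec m)).integrableOn
  · intro m _ m' _ hmm
    refine Set.disjoint_left.2 fun x hx hx' => hmm ?_
    funext i
    have h1 := hx i
    have h2 := hx' i
    simp only [Pi.add_apply, Pi.neg_apply, intVec, Set.mem_Ioc] at h1 h2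
    have h3 : (m i : ℝ) < m' i + 1 := by linarith
    have h4 : (m' i : ℝ) < m i + 1 := by linarith
    norm_cast at h3 h4
    omega

/-! ### Weak derivatives on the cube and their Fourier transforms. -/

section WeakDerivatives

open Filter Topology

theorem Filter.EventuallyEq.partialDeriv {d : ℕ} {j : Fin d} {φ ψ : (Fin d → ℝ) → ℝ}
    {x : Fin d → ℝ} (h : φ =ᶠ[𝓝 x] ψ) : partialDeriv j φ =ᶠ[𝓝 x] partialDeriv j ψ :=
  (h.fderiv (𝕜 := ℝ)).mono fun y hy => by simp only [_root_.partialDeriv, hy]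

theorem Filter.EventuallyEq.iterate_partialDeriv {d : ℕ} {j : Fin d} {φ ψ : (Fin d → ℝ) → ℝ}
    {x : Fin d → ℝ} (h : φ =ᶠ[𝓝 x] ψ) (n : ℕ) :
    (_root_.partialDeriv j)^[n] φ =ᶠ[𝓝 x] (_root_.partialDeriv j)^[n] ψ := by
  induction n generalizing φ ψ with
  | zero => exact h
  | succ n ih => exact ih h.partialDeriv

theorem Filter.EventuallyEq.multiDeriv {d : ℕ} {φ ψ : (Fin d → ℝ) → ℝ}
    {x : Fin d → ℝ} (h : φ =ᶠ[𝓝 x] ψ) (α : Fin d → ℕ) :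
    multiDeriv α φ =ᶠ[𝓝 x] multiDeriv α ψ := by
  unfold _root_.multiDeriv
  induction List.finRange d with
  | nil => exact h
  | cons i l ih => exact ih.iterate_partialDeriv _

theorem iterate_partialDeriv_zero {d : ℕ} (j : Fin d) (n : ℕ) :
    (partialDeriv j)^[n] (0 : (Fin d → ℝ) → ℝ) = 0 := by
  refine Function.iterate_fixed ?_ n
  funext x
  simp [partialDeriv]

theorem multiDeriv_zero {d : ℕ} (α : Fin d → ℕ) : multiDeriv α (0 : (Fin d → ℝ) → ℝ) = 0 := by
  unfold multiDeriv
  induction List.finRange d with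
  | nil => rfl
  | cons i l ih => rw [List.foldr_cons, ih, iterate_partialDeriv_zero]

theorem multiDeriv_eq_zero_of_notMem_tsupport {d : ℕ} (α : Fin d → ℕ) {φ : (Fin d → ℝ) → ℝ}
    {x : Fin d → ℝ} (hx : x ∉ tsupport φ) : multiDeriv α φ x = 0 := by
  have h := ((notMem_tsupport_iff_eventuallyEq.1 hx).multiDeriv α).self_of_nhds
  rw [h, multiDeriv_zero, Pi.zero_apply]

theorem multiDeriv_single {d : ℕ} (j : Fin d) (n : ℕ) (φ : (Fin d → ℝ) → ℝ) :
    multiDeriv (Pi.single j n) φ = (partialDeriv j)^[n] φ := by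
  have key : ∀ l : List (Fin d), l.Nodup →
      l.foldr (fun i ψ => (partialDeriv i)^[(Pi.single j n : Fin d → ℕ) i] ψ) φ =
        if j ∈ l then (partialDeriv j)^[n] φ else φ := by
    intro l hl
    induction l with
    | nil => simp
    | cons i l ih =>
      rw [List.nodup_cons] at hl
      rw [List.foldr_cons, ih hl.2]
      by_cases hij : i = j
      · subst hij
        simp [hl.1]
      · simp [Ne.symm hij]
  rw [multiDeriv, key _ (List.nodup_finRange d), if_pos (List.mem_finRange j)]

theorem multiLength_single {d : ℕ} (j : Fin d) (n : ℕ) :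
    multiLength (Pi.single j n : Fin d → ℕ) = n := by
  simp [multiLength]

/-- Each derivative brings out `ξ j` and advances the phase by `π/2`. Keeping everything as a cosine
with a phase stays within real-valued test functions. -/
theorem iterate_partialDeriv_cos {d : ℕ} (j : Fin d) (n : ℕ) (ξ : Fin d → ℝ) (a θ : ℝ) :
    (partialDeriv j)^[n] (fun x => a * Real.cos (ξ ⬝ᵥ x + θ)) =
      fun x => a * ξ j ^ n * Real.cos (ξ ⬝ᵥ x + (θ + n * (Real.pi / 2))) := by
  induction n generalizing a θ with
  | zero => simp
  | succ n ih =>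
    have h1 : partialDeriv j (fun x => a * Real.cos (ξ ⬝ᵥ x + θ)) =
        fun x => (a * ξ j) * Real.cos (ξ ⬝ᵥ x + (θ + Real.pi / 2)) := by
      funext x
      let L : (Fin d → ℝ) →L[ℝ] ℝ := LinearMap.toContinuousLinearMap (dotProductBilin ℝ ℝ ξ)
      have hL : HasFDerivAt (fun x : Fin d → ℝ => ξ ⬝ᵥ x) L x := L.hasFDerivAt
      have := ((hL.add_const θ).cos.const_mul a).fderiv
      rw [partialDeriv, this]
      have hj : L (Pi.single j 1) = ξ j := by
        change ξ ⬝ᵥ Pi.single j 1 = ξ j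
        simp
      rw [← add_assoc, Real.cos_add_pi_div_two]
      simp only [smul_apply, hj, smul_eq_mul]
      ring
    rw [Function.iterate_succ_apply, h1, ih]
    funext x
    push_cast
    ring_nf

theorem isOpen_openUnitCube (d : ℕ) : IsOpen (openUnitCube d) :=
  isOpen_set_pi Set.finite_univ fun _ _ => isOpen_Ioo

theorem openUnitCube_subset_Icc (d : ℕ) :
    openUnitCube d ⊆ Set.Icc (fun _ : Fin d => (0 : ℝ)) (fun _ => 1) := fun _ hx =>
  ⟨fun i => (hx i trivial).1.le, fun i => (hx i trivial).2.le⟩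

theorem openUnitCube_ae_eq_Icc (d : ℕ) :
    openUnitCube d =ᵐ[volume] Set.Icc (fun _ : Fin d => (0 : ℝ)) (fun _ => 1) :=
  Measure.univ_pi_Ioo_ae_eq_Icc

theorem HasWeakDeriv.restrict_of_univ {d : ℕ} {Ω : Set (Fin d → ℝ)} {α : Fin d → ℕ}
    {f g : (Fin d → ℝ) → ℝ} (h : HasWeakDeriv Set.univ α f g) : HasWeakDeriv Ω α f g where
  locallyIntegrable := h.locallyIntegrable.mono_set (Set.subset_univ _)
  locallyIntegrable_deriv := h.locallyIntegrable_deriv.mono_set (Set.subset_univ _)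
  integral_eq φ hφ hc hs := by
    have h0 := h.integral_eq φ hφ hc (Set.subset_univ _)
    rw [setIntegral_eq_integral_of_forall_compl_eq_zero,
      setIntegral_eq_integral_of_forall_compl_eq_zero]
    · simpa using h0
    · intro x hx
      rw [image_eq_zero_of_notMem_tsupport fun h' => hx (hs h'), mul_zero]
    · intro x hx
      rw [multiDeriv_eq_zero_of_notMem_tsupport α fun h' => hx (hs h'), mul_zero]

theorem weakDeriv_spec {d : ℕ} {Ω : Set (Fin d → ℝ)} {α : Fin d → ℕ}
    {f : (Fin d → ℝ) → ℝ}
    (h : ∃ g : (Fin d → ℝ) → ℝ, MemLp g 2 (volume.restrict Ω) ∧ HasWeakDeriv Ω α f g) :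
    MemLp (weakDeriv Ω α f) 2 (volume.restrict Ω) ∧ HasWeakDeriv Ω α f (weakDeriv Ω α f) := by
  rw [weakDeriv, dif_pos h]
  exact Classical.choose_spec h

theorem HasWeakDeriv.ae_eq {d : ℕ} {Ω : Set (Fin d → ℝ)} (hΩ : IsOpen Ω) {α : Fin d → ℕ}
    {f g h : (Fin d → ℝ) → ℝ} (hg : HasWeakDeriv Ω α f g) (hh : HasWeakDeriv Ω α f h)
    (hg2 : MemLp g 2 (volume.restrict Ω)) (hh2 : MemLp h 2 (volume.restrict Ω)) :
    ∀ᵐ x, x ∈ Ω → g x = h x := by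
  have := hΩ.ae_eq_zero_of_integral_contDiff_smul_eq_zero (f := fun x => g x - h x) (μ := volume)
    (hg.locallyIntegrable_deriv.sub hh.locallyIntegrable_deriv) ?_
  · filter_upwards [this] with x hx hxΩ
    exact sub_eq_zero.1 (hx hxΩ)
  intro φ hφ hc hs
  have hφ2 : MemLp φ 2 (volume.restrict Ω) :=
    (hφ.continuous.memLp_of_hasCompactSupport hc).restrict Ω
  rw [← setIntegral_eq_integral_of_forall_compl_eq_zero (s := Ω)]
  · simp only [smul_eq_mul, mul_sub]
    refine (integral_sub (hφ2.integrable_mul hg2) (hφ2.integrable_mul hh2)).trans ?_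
    have h1 := (hg.integral_eq φ hφ hc hs).symm.trans (hh.integral_eq φ hφ hc hs)
    simp only [Pi.mul_apply, mul_comm (φ _)]
    rw [sub_eq_zero]
    exact mul_left_cancel₀ (pow_ne_zero _ (by norm_num)) h1
  · intro x hx
    rw [image_eq_zero_of_notMem_tsupport fun h' => hx (hs h'), zero_smul]

/-- The weak derivative on the open cube, extended by zero, of a function in `H̊^s`. -/
noncomputable def zeroExtWeakDeriv {d : ℕ} (α : Fin d → ℕ) (f : (Fin d → ℝ) → ℝ) :
    (Fin d → ℝ) → ℝ :=
  (openUnitCube d).indicator (weakDeriv (openUnitCube d) α f)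

/-- Bridges the norm, defined by weak derivatives on the open cube, and integration by parts on all
of `ℝ^d`. The global derivative agrees with the local one inside the cube, vanishes outside the
closed cube because `f` does, and the boundary is null; so no boundary terms arise. -/
theorem MemIsoSobolevZero.zeroExtWeakDeriv_spec {d s : ℕ} {f : (Fin d → ℝ) → ℝ}
    (hf : MemIsoSobolevZero s f) {α : Fin d → ℕ} (hα : multiLength α ≤ s) :
    MemLp (zeroExtWeakDeriv α f) 2 ∧ ∀ φ : (Fin d → ℝ) → ℝ, ContDiff ℝ ∞ φ → HasCompactSupport φ →
      ∫ x, f x * multiDeriv α φ x = (-1 : ℝ) ^ multiLength α * ∫ x, zeroExtWeakDeriv α f x * φ x := by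
  obtain ⟨g, hg2, hg⟩ := hf.memSobolev.2 α hα
  have hg2Ω : MemLp g 2 (volume.restrict (openUnitCube d)) := by
    rw [Measure.restrict_univ] at hg2
    exact hg2.restrict _
  have hw := weakDeriv_spec ⟨g, hg2Ω, hg.restrict_of_univ⟩
  have hin := hg.restrict_of_univ.ae_eq (isOpen_openUnitCube d) hw.2 hg2Ω hw.1
  have hout : ∀ᵐ x, x ∈ (Set.Icc (fun _ : Fin d => (0 : ℝ)) (fun _ => 1))ᶜ → g x = 0 := by
    refine isClosed_Icc.isOpen_compl.ae_eq_zero_of_integral_contDiff_smul_eq_zero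
      (hg.locallyIntegrable_deriv.mono_set (Set.subset_univ _)) fun φ hφ hc hs => ?_
    have h1 := hg.integral_eq φ hφ hc (Set.subset_univ _)
    have h2 : ∀ x, f x * multiDeriv α φ x = 0 := by
      intro x
      by_cases hx : x ∈ tsupport φ
      · rw [image_eq_zero_of_notMem_tsupport fun h' => hs hx (hf.support_subset h'), zero_mul]
      · rw [multiDeriv_eq_zero_of_notMem_tsupport α hx, mul_zero]
    simp only [h2, integral_zero, Measure.restrict_univ] at h1
    simp only [smul_eq_mul, mul_comm (φ _)]
    exact (mul_eq_zero.1 h1.symm).resolve_left (pow_ne_zero _ (by norm_num))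
  have hae : g =ᵐ[volume] zeroExtWeakDeriv α f := by
    filter_upwards [hin, hout, openUnitCube_ae_eq_Icc d] with x h1 h2 h3
    have h3' : x ∈ openUnitCube d ↔ x ∈ Set.Icc (fun _ : Fin d => (0 : ℝ)) (fun _ => 1) :=
      iff_of_eq h3
    by_cases hx : x ∈ openUnitCube d
    · rw [zeroExtWeakDeriv, Set.indicator_of_mem hx, h1 hx]
    · rw [zeroExtWeakDeriv, Set.indicator_of_notMem hx, h2 fun h => hx (h3'.2 h)]
  refine ⟨?_, fun φ hφ hc => ?_⟩
  · rw [Measure.restrict_univ] at hg2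
    exact hg2.ae_eq hae
  · have h1 := hg.integral_eq φ hφ hc (Set.subset_univ _)
    rw [Measure.restrict_univ] at h1
    rw [h1]
    congr 1
    refine integral_congr_ae ?_
    filter_upwards [hae] with x hx
    rw [hx]

/-- Removes compact support of the test function, so that cosines become admissible: a cutoff equal
to `1` near the cube changes neither side. -/
theorem MemIsoSobolevZero.integral_mul_iterate_partialDeriv {d s : ℕ} {f : (Fin d → ℝ) → ℝ}
    (hf : MemIsoSobolevZero s f) (j : Fin d) {ψ : (Fin d → ℝ) → ℝ} (hψ : ContDiff ℝ ∞ ψ) :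
    ∫ x, f x * (partialDeriv j)^[s] ψ x =
      (-1 : ℝ) ^ s * ∫ x, zeroExtWeakDeriv (Pi.single j s) f x * ψ x := by
  let χ : ContDiffBump (0 : Fin d → ℝ) := ⟨2, 3, by norm_num, by norm_num⟩
  have hK : Set.Icc (fun _ : Fin d => (0 : ℝ)) (fun _ => 1) ⊆ Metric.ball 0 2 := by
    intro x hx
    rw [mem_ball_zero_iff, pi_norm_lt_iff (by norm_num)]
    intro i
    have h1 : 0 ≤ x i := hx.1 i
    have h2 : x i ≤ 1 := hx.2 i
    rw [Real.norm_eq_abs, abs_of_nonneg h1]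
    linarith
  have heq : ∀ x ∈ Set.Icc (fun _ : Fin d => (0 : ℝ)) (fun _ => 1),
      (fun y => χ y * ψ y) =ᶠ[𝓝 x] ψ := by
    intro x hx
    filter_upwards [χ.eventuallyEq_one_of_mem_ball (hK hx)] with y hy
    simp [hy]
  have h := (hf.zeroExtWeakDeriv_spec (multiLength_single j s).le).2 (fun y => χ y * ψ y)
    (χ.contDiff.mul hψ) χ.hasCompactSupport.mul_right
  rw [multiLength_single, multiDeriv_single] at h
  have h1 : ∀ x, f x * (partialDeriv j)^[s] (fun y => χ y * ψ y) x =
      f x * (partialDeriv j)^[s] ψ x := by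
    intro x
    by_cases hx : x ∈ Set.Icc (fun _ : Fin d => (0 : ℝ)) (fun _ => 1)
    · rw [((heq x hx).iterate_partialDeriv s).self_of_nhds]
    · rw [image_eq_zero_of_notMem_tsupport fun h' => hx (hf.support_subset h'), zero_mul, zero_mul]
  have h2 : ∀ x, zeroExtWeakDeriv (Pi.single j s) f x * (χ x * ψ x) =
      zeroExtWeakDeriv (Pi.single j s) f x * ψ x := by
    intro x
    by_cases hx : x ∈ openUnitCube d
    · exact congrArg _ (heq x (openUnitCube_subset_Icc d hx)).self_of_nhds
    · rw [zeroExtWeakDeriv, Set.indicator_of_notMem hx, zero_mul, zero_mul]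
  simpa only [h1, h2] using h

theorem integrable_zeroExtWeakDeriv {d s : ℕ} {f : (Fin d → ℝ) → ℝ}
    (hf : MemIsoSobolevZero s f) {α : Fin d → ℕ} (hα : multiLength α ≤ s) :
    Integrable (zeroExtWeakDeriv α f) := by
  have h := (hf.zeroExtWeakDeriv_spec hα).1.restrict (openUnitCube d)
  have hfin : IsFiniteMeasure (volume.restrict (openUnitCube d)) := by
    refine ⟨?_⟩
    rw [Measure.restrict_apply_univ]
    exact (measure_mono (openUnitCube_subset_Icc d)).trans_lt isCompact_Icc.measure_lt_top
  have h1 : IntegrableOn (zeroExtWeakDeriv α f) (openUnitCube d) := h.integrable (by norm_num)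
  exact (integrableOn_iff_integrable_of_support_subset Set.support_indicator_subset).1 h1

theorem MemIsoSobolevZero.integrable {d s : ℕ} {f : (Fin d → ℝ) → ℝ}
    (hf : MemIsoSobolevZero s f) : Integrable f :=
  hf.continuous.integrable_of_hasCompactSupport
    (isCompact_Icc.of_isClosed_subset (isClosed_tsupport f) hf.support_subset)

/-- The real part of `e^{iθ} ∫ f(x) e^{iξ·x} dx`. -/
theorem integral_mul_cos_eq_re {d : ℕ} {f : (Fin d → ℝ) → ℝ} (hf : Integrable f)
    (ξ : Fin d → ℝ) (θ : ℝ) :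
    ∫ x, f x * Real.cos (ξ ⬝ᵥ x + θ) =
      (Complex.exp (θ * Complex.I) *
        ∫ x, Complex.exp ((ξ ⬝ᵥ x : ℝ) * Complex.I) * (f x : ℂ)).re := by
  rw [← integral_const_mul]
  have hcont : Continuous fun x : Fin d → ℝ => Complex.exp ((ξ ⬝ᵥ x : ℝ) * Complex.I) := by
    simp only [dotProduct]
    fun_prop
  have hint : Integrable fun x => Complex.exp (θ * Complex.I) *
      (Complex.exp ((ξ ⬝ᵥ x : ℝ) * Complex.I) * (f x : ℂ)) := by
    refine Integrable.const_mul ?_ _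
    refine hf.ofReal.bdd_mul (c := 1) hcont.aestronglyMeasurable (ae_of_all _ fun x => ?_)
    rw [Complex.norm_exp_ofReal_mul_I]
  have := integral_re hint
  simp only [RCLike.re_to_complex] at this
  rw [← this]
  congr 1
  funext x
  rw [← mul_assoc, ← Complex.exp_add, ← add_mul, ← Complex.ofReal_add, Complex.re_mul_ofReal,
    Complex.exp_ofReal_mul_I_re, mul_comm, add_comm θ]

/-- The Fourier transform of the pure derivative of order `s` in direction `j`. -/
theorem MemIsoSobolevZero.abs_pow_mul_norm_integral_exp {d s : ℕ} {f : (Fin d → ℝ) → ℝ}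
    (hf : MemIsoSobolevZero s f) (j : Fin d) (ξ : Fin d → ℝ) :
    |ξ j| ^ s * ‖∫ x, Complex.exp ((ξ ⬝ᵥ x : ℝ) * Complex.I) * (f x : ℂ)‖ =
      ‖∫ x, Complex.exp ((ξ ⬝ᵥ x : ℝ) * Complex.I) *
        (zeroExtWeakDeriv (Pi.single j s) f x : ℂ)‖ := by
  set u := ∫ x, Complex.exp ((ξ ⬝ᵥ x : ℝ) * Complex.I) * (f x : ℂ)
  set w := ∫ x, Complex.exp ((ξ ⬝ᵥ x : ℝ) * Complex.I) *
        (zeroExtWeakDeriv (Pi.single j s) f x : ℂ)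
  -- Testing against `cos(ξ·x + θ)` for every `θ` gives the real part of each rotation of the
  -- complex identity `z = 0`.
  have key : ∀ θ : ℝ, ξ j ^ s * (Complex.exp ((θ + s * (Real.pi / 2) : ℝ) * Complex.I) * u).re =
      (-1) ^ s * (Complex.exp (θ * Complex.I) * w).re := by
    intro θ
    have hψ : ContDiff ℝ ∞ fun x : Fin d → ℝ => 1 * Real.cos (ξ ⬝ᵥ x + θ) := by
      simp only [dotProduct]
      fun_prop
    have h := hf.integral_mul_iterate_partialDeriv j hψ
    rw [iterate_partialDeriv_cos] at h
    simp only [one_mul] at h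
    rw [integral_mul_cos_eq_re (integrable_zeroExtWeakDeriv hf (multiLength_single j s).le)] at h
    rw [← h, ← integral_mul_cos_eq_re hf.integrable, ← integral_const_mul]
    congr 1
    funext x
    ring
  set z : ℂ := ξ j ^ s * Complex.exp ((s * (Real.pi / 2) : ℝ) * Complex.I) * u - (-1) ^ s * w
    with hz
  have hre : ∀ θ : ℝ, (Complex.exp (θ * Complex.I) * z).re = 0 := by
    intro θ
    have h := key θ
    rw [← Complex.re_ofReal_mul, ← Complex.re_ofReal_mul] at h
    rw [← sub_eq_zero, ← Complex.sub_re] at h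
    rw [← h, hz]
    congr 1
    push_cast
    rw [add_mul, Complex.exp_add]
    ring
  have hz0 : z = 0 := by
    refine Complex.ext ?_ ?_
    · simpa using hre 0
    -- Rotation by `-π/2` turns the real part into the imaginary part of `z`.
    · have h := hre (-(Real.pi / 2))
      rw [Complex.mul_re, Complex.exp_ofReal_mul_I_re, Complex.exp_ofReal_mul_I_im] at h
      simpa using h
  have h := congrArg norm (sub_eq_zero.1 (hz ▸ hz0))
  rw [norm_mul, norm_mul, norm_mul, Complex.norm_exp_ofReal_mul_I] at h
  simpa using h

end WeakDerivatives

/-! ### Error bound for a general shifted lattice rule. -/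

section LatticeRule

theorem Real.summable_mul_and_tsum_mul_le_sqrt_mul_sqrt {ι : Type*} {p q : ι → ℝ}
    (hp : ∀ i, 0 ≤ p i) (hq : ∀ i, 0 ≤ q i) (hp2 : Summable fun i => p i ^ 2)
    (hq2 : Summable fun i => q i ^ 2) :
    (Summable fun i => p i * q i) ∧
      ∑' i, p i * q i ≤ √(∑' i, p i ^ 2) * √(∑' i, q i ^ 2) := by
  have h : ∀ u : Finset ι, ∑ i ∈ u, p i * q i ≤ √(∑' i, p i ^ 2) * √(∑' i, q i ^ 2) := by
    intro u
    refine (Real.sum_mul_le_sqrt_mul_sqrt u p q).trans ?_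
    gcongr
    · exact hp2.sum_le_tsum u fun i _ => sq_nonneg _
    · exact hq2.sum_le_tsum u fun i _ => sq_nonneg _
  have hnn : ∀ i, 0 ≤ p i * q i := fun i => mul_nonneg (hp i) (hq i)
  have hs := summable_of_sum_le hnn h
  exact ⟨hs, hs.tsum_le_of_sum_le h⟩

/-- The points are those of a lattice of rank `d`, where inverse powers above the rank are summable.
The term at `k = 0` is `0`, since `0⁻¹ = 0` and `n > 0`. -/
theorem summable_norm_intVec_inv_pow {d n : ℕ} (h : d < n) :
    Summable fun k : Fin d → ℤ => ‖intVec k‖⁻¹ ^ n := by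
  let b := Pi.basisFun ℝ (Fin d)
  let L := Submodule.span ℤ (Set.range b)
  have hr : Module.finrank ℤ L = d := by
    rw [ZLattice.rank ℝ L, Module.finrank_fin_fun]
  have hmem : ∀ k : Fin d → ℤ, intVec k ∈ L := by
    intro k
    have : intVec k = ∑ i, k i • b i := by
      funext j
      simp [intVec, b, Pi.single_apply]
    rw [this]
    exact Submodule.sum_mem _ fun i _ => L.smul_mem _ (Submodule.subset_span ⟨i, rfl⟩)
  have hs := ZLattice.summable_norm_pow_inv L n (hr.trans_lt h)
  refine hs.comp_injective (i := fun k => (⟨intVec k, hmem k⟩ : L)) fun k k' hk => ?_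
  funext j
  exact Int.cast_injective (α := ℝ) (congrFun (congrArg Subtype.val hk) j)

/-- The affine map `y ↦ S^{-⊤}(y + v)` taking `ℤ^d` to the nodes of the quadrature rule. -/
noncomputable def nodeMap {d : ℕ} (S : Matrix (Fin d) (Fin d) ℝ) (v y : Fin d → ℝ) : Fin d → ℝ :=
  (S⁻¹).transpose.mulVec (y + v)

variable {d : ℕ} {S : Matrix (Fin d) (Fin d) ℝ}

theorem transpose_mulVec_nodeMap (hS : IsUnit S.det) (v y : Fin d → ℝ) :
    S.transpose.mulVec (nodeMap S v y) = y + v := by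
  rw [nodeMap, Matrix.mulVec_mulVec, ← Matrix.transpose_mul, Matrix.nonsing_inv_mul _ hS,
    Matrix.transpose_one, Matrix.one_mulVec]

theorem continuous_nodeMap (S : Matrix (Fin d) (Fin d) ℝ) (v : Fin d → ℝ) :
    Continuous (nodeMap S v) := by
  unfold nodeMap
  fun_prop

theorem map_nodeMap_volume (hS : IsUnit S.det) (v : Fin d → ℝ) :
    Measure.map (nodeMap S v) volume = ENNReal.ofReal |S.det| • volume := by
  have hdet : (S⁻¹).transpose.det ≠ 0 := by
    rw [Matrix.det_transpose]
    exact (S.isUnit_nonsing_inv_det hS).ne_zero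
  have h1 : nodeMap S v = Matrix.toLin' (S⁻¹).transpose ∘ fun y => y + v := rfl
  have hm : Measurable (Matrix.toLin' (S⁻¹).transpose) :=
    (LinearMap.continuous_of_finiteDimensional _).measurable
  rw [h1, ← Measure.map_map hm (measurable_add_const v), map_add_right_eq_self,
    Real.map_matrix_volume_pi_eq_smul_volume_pi hdet, Matrix.det_transpose, Matrix.det_nonsing_inv,
    Ring.inverse_eq_inv', inv_inv]

theorem measurableEmbedding_nodeMap (hS : IsUnit S.det) (v : Fin d → ℝ) :
    MeasurableEmbedding (nodeMap S v) := by
  refine (continuous_nodeMap S v).measurableEmbedding fun y y' h => ?_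
  have := congrArg S.transpose.mulVec h
  simpa [transpose_mulVec_nodeMap hS] using this

theorem integral_comp_nodeMap {E : Type*} [NormedAddCommGroup E] [NormedSpace ℝ E]
    (hS : IsUnit S.det) (v : Fin d → ℝ) (H : (Fin d → ℝ) → E) :
    ∫ y, H (nodeMap S v y) = |S.det| • ∫ x, H x := by
  rw [← (measurableEmbedding_nodeMap hS v).integral_map, map_nodeMap_volume hS,
    integral_smul_measure, ENNReal.toReal_ofReal (abs_nonneg _)]

theorem MeasureTheory.MemLp.comp_nodeMap {E : Type*} [NormedAddCommGroup E] {p : ENNReal}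
    (hS : IsUnit S.det) (v : Fin d → ℝ) {H : (Fin d → ℝ) → E} (hH : MemLp H p) :
    MemLp (fun y => H (nodeMap S v y)) p := by
  have h : MemLp H p (Measure.map (nodeMap S v) volume) := by
    rw [map_nodeMap_volume hS]
    exact hH.smul_measure ENNReal.ofReal_ne_top
  exact ((measurableEmbedding_nodeMap hS v).memLp_map_measure_iff).1 h

theorem latticeChar_eq_exp_nodeMap (hS : IsUnit S.det) (v : Fin d → ℝ) (k : Fin d → ℤ)
    (y : Fin d → ℝ) :
    latticeChar (-k) y = latticeChar (-k) (-v) *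
      Complex.exp ((((-(2 * Real.pi)) • S.mulVec (intVec k)) ⬝ᵥ nodeMap S v y : ℝ) * Complex.I) := by
  have h : S.mulVec (intVec k) ⬝ᵥ nodeMap S v y = intVec k ⬝ᵥ (y + v) := by
    rw [← transpose_mulVec_nodeMap hS v y, Matrix.dotProduct_mulVec, Matrix.vecMul_transpose]
  have h' : intVec (-k) = -intVec k := by
    funext i
    simp [intVec]
  rw [latticeChar_eq_exp, latticeChar_eq_exp, ← Complex.exp_add, smul_dotProduct, h, h',
    dotProduct_add, neg_dotProduct, neg_dotProduct, dotProduct_neg, smul_eq_mul]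
  congr 1
  push_cast
  ring

/-- The Fourier coefficients of the periodization of `H ∘ nodeMap S v`, up to a phase. -/
theorem norm_integral_latticeChar_mul_comp_nodeMap (hS : IsUnit S.det) (v : Fin d → ℝ)
    (k : Fin d → ℤ) (H : (Fin d → ℝ) → ℝ) :
    ‖∫ y, latticeChar (-k) y * (H (nodeMap S v y) : ℂ)‖ = |S.det| *
      ‖∫ x, Complex.exp ((((-(2 * Real.pi)) • S.mulVec (intVec k)) ⬝ᵥ x : ℝ) * Complex.I) *
        (H x : ℂ)‖ := by
  have h : (fun y => latticeChar (-k) y * (H (nodeMap S v y) : ℂ)) = fun y =>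
      latticeChar (-k) (-v) * (Complex.exp
        ((((-(2 * Real.pi)) • S.mulVec (intVec k)) ⬝ᵥ nodeMap S v y : ℝ) * Complex.I) *
          (H (nodeMap S v y) : ℂ)) := by
    funext y
    rw [latticeChar_eq_exp_nodeMap hS v k y, mul_assoc]
  rw [h, integral_const_mul, norm_mul, norm_latticeChar, one_mul,
    integral_comp_nodeMap hS v (fun x => Complex.exp
      ((((-(2 * Real.pi)) • S.mulVec (intVec k)) ⬝ᵥ x : ℝ) * Complex.I) * (H x : ℂ)),
    norm_smul, Real.norm_eq_abs, abs_abs]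

/-- The character is `ℤ^d`-periodic, so it passes inside the periodization and the sum of integrals
over translated boxes unfolds to `ℝ^d`. -/
theorem integral_latticeChar_mul_sum {F : (Fin d → ℝ) → ℂ} (hF : Integrable F)
    (M : Finset (Fin d → ℤ)) (hM : ∀ m, ∀ y ∈ unitBox d, F (y + intVec m) ≠ 0 → m ∈ M)
    (k : Fin d → ℤ) :
    ∫ y in unitBox d, latticeChar k y * ∑ m ∈ M, F (y + intVec m) =
      ∫ y, latticeChar k y * F y := by
  rw [integral_eq_setIntegral_unitBox_sum (M := M)]
  · simp_rw [latticeChar_add_intVec, Finset.mul_sum]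
  · exact hF.bdd_mul (c := 1) (continuous_latticeChar k).aestronglyMeasurable
      (ae_of_all _ fun x => (norm_latticeChar k x).le)
  · intro m y hy hne
    exact hM m y hy fun h => hne (by rw [h, mul_zero])

/-- Bessel's inequality for the periodization of a square-integrable function. -/
theorem summable_tsum_sq_integral_latticeChar_le {F : (Fin d → ℝ) → ℂ} (hF : Integrable F)
    (hF2 : MemLp F 2)
    (M : Finset (Fin d → ℤ)) (hM : ∀ m, ∀ y ∈ unitBox d, F (y + intVec m) ≠ 0 → m ∈ M) :
    (Summable fun k : Fin d → ℤ => ‖∫ y, latticeChar (-k) y * F y‖ ^ 2) ∧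
      ∑' k : Fin d → ℤ, ‖∫ y, latticeChar (-k) y * F y‖ ^ 2 ≤ M.card * ∫ y, ‖F y‖ ^ 2 := by
  have hmem : ∀ m : Fin d → ℤ, MemLp (fun y => F (y + intVec m)) 2 := fun m =>
    hF2.comp_measurePreserving (measurePreserving_add_right volume (intVec m))
  have hQ : MemLp (fun y => ∑ m ∈ M, F (y + intVec m)) 2 (volume.restrict (unitBox d)) :=
    memLp_finsetSum M fun m _ => (hmem m).restrict _
  have h := hasSum_sq_integral_latticeChar hQ
  simp_rw [integral_latticeChar_mul_sum hF M hM] at h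
  refine ⟨h.summable, h.tsum_eq.trans_le ?_⟩
  have hsq : Integrable fun y => ‖F y‖ ^ 2 := hF2.integrable_norm_pow two_ne_zero
  rw [integral_eq_setIntegral_unitBox_sum hsq M fun m y hy hne => hM m y hy fun h =>
    hne (by simp [h]), ← integral_const_mul]
  refine integral_mono (hQ.integrable_norm_pow two_ne_zero) ?_ fun y => ?_
  · exact (integrable_finsetSum M fun m _ =>
      (hsq.comp_add_right (intVec m)).restrict).const_mul _
  -- Cauchy–Schwarz over the translates is what costs the factor `M.card`.
  · calc ‖∑ m ∈ M, F (y + intVec m)‖ ^ 2 ≤ (∑ m ∈ M, ‖F (y + intVec m)‖) ^ 2 := by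
          gcongr
          exact norm_sum_le _ _
      _ ≤ M.card * ∑ m ∈ M, ‖F (y + intVec m)‖ ^ 2 := sq_sum_le_card_mul_sum_sq

/-- The translates of the unit box meeting the preimage of the unit cube lie in a box. -/
theorem intVec_bounds_of_nodeMap_mem (hS : IsUnit S.det) {r : ℝ}
    (hr : ∀ x ∈ Set.Icc (fun _ : Fin d => (0 : ℝ)) (fun _ => 1), ∀ j,
      |S.transpose.mulVec x j| ≤ r) {v y : Fin d → ℝ} {m : Fin d → ℤ}
    (h : nodeMap S v (y + intVec m) ∈ Set.Icc (fun _ : Fin d => (0 : ℝ)) (fun _ => 1)) (j : Fin d) :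
    |y j + m j + v j| ≤ r := by
  have := hr _ h j
  rwa [transpose_mulVec_nodeMap hS] at this

theorem exists_finset_card_le_of_nodeMap_mem (hS : IsUnit S.det) {r : ℝ} (hr0 : 0 ≤ r)
    (hr : ∀ x ∈ Set.Icc (fun _ : Fin d => (0 : ℝ)) (fun _ => 1), ∀ j,
      |S.transpose.mulVec x j| ≤ r) (v : Fin d → ℝ) :
    ∃ M : Finset (Fin d → ℤ), (M.card : ℝ) ≤ (2 * r + 2) ^ d ∧ ∀ m, ∀ y ∈ unitBox d,
      nodeMap S v (y + intVec m) ∈ Set.Icc (fun _ : Fin d => (0 : ℝ)) (fun _ => 1) → m ∈ M := by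
  -- From `|y j + m j + v j| ≤ r` and `0 < y j ≤ 1`, each `m j` lies in an interval of length `2r +
  -- 1`, hence takes at most `2r + 2` values.
  refine ⟨Finset.Icc (fun j => ⌈-v j - 1 - r⌉) (fun j => ⌊-v j + r⌋), ?_, fun m y hy h => ?_⟩
  · rw [Pi.card_Icc, Nat.cast_prod]
    calc _ ≤ ∏ _j : Fin d, (2 * r + 2) := by
          refine Finset.prod_le_prod (fun _ _ => Nat.cast_nonneg _) fun j _ => ?_
          rw [Int.card_Icc, ← Int.cast_natCast, Int.toNat_eq_max, Int.cast_max]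
          refine max_le ?_ (by push_cast; linarith)
          have h1 := Int.floor_le (-v j + r)
          have h2 := Int.le_ceil (-v j - 1 - r)
          push_cast
          linarith
      _ = (2 * r + 2) ^ d := by simp
  · have hb := fun j => abs_le.1 (intVec_bounds_of_nodeMap_mem hS hr h j)
    have hy' := fun j => hy j
    rw [Finset.mem_Icc]
    refine ⟨fun j => Int.ceil_le.2 ?_, fun j => Int.le_floor.2 ?_⟩
    · linarith [(hb j).1, (hy j).2]
    · linarith [(hb j).2, (hy j).1]

/-- The sum is locally finite: for `y` in a unit ball only finitely many `m` bring the node into the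
cube. -/
theorem continuous_tsum_comp_nodeMap (hS : IsUnit S.det) {r : ℝ}
    (hr : ∀ x ∈ Set.Icc (fun _ : Fin d => (0 : ℝ)) (fun _ => 1), ∀ j,
      |S.transpose.mulVec x j| ≤ r) (v : Fin d → ℝ) {F : (Fin d → ℝ) → ℂ} (hF : Continuous F)
    (hsupp : ∀ x, F x ≠ 0 → x ∈ Set.Icc (fun _ : Fin d => (0 : ℝ)) (fun _ => 1)) :
    Continuous fun y => ∑' m : Fin d → ℤ, F (nodeMap S v (y + intVec m)) := by
  have hfin : ∀ y0 : Fin d → ℝ, {m : Fin d → ℤ | ∃ y ∈ Metric.ball y0 1,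
      F (nodeMap S v (y + intVec m)) ≠ 0}.Finite := by
    intro y0
    refine (Set.finite_Icc (fun j => ⌈-r - 1 - y0 j - v j⌉) (fun j => ⌊r + 1 - y0 j - v j⌋)).subset ?_
    rintro m ⟨y, hy, hne⟩
    have hb := fun j => abs_le.1 (intVec_bounds_of_nodeMap_mem hS hr (hsupp _ hne) j)
    have hy' : ∀ j, |y j - y0 j| < 1 := fun j => by
      rw [← Real.dist_eq]
      exact (dist_le_pi_dist y y0 j).trans_lt hy
    refine ⟨fun j => Int.ceil_le.2 ?_, fun j => Int.le_floor.2 ?_⟩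
    · linarith [(hb j).1, (abs_lt.1 (hy' j)).2]
    · linarith [(hb j).2, (abs_lt.1 (hy' j)).1]
  have hcont : ∀ m : Fin d → ℤ, Continuous fun y => F (nodeMap S v (y + intVec m)) := fun m =>
    hF.comp ((continuous_nodeMap S v).comp (continuous_add_const (intVec m)))
  have h : (fun y => ∑' m : Fin d → ℤ, F (nodeMap S v (y + intVec m))) =
      fun y => ∑ᶠ m : Fin d → ℤ, F (nodeMap S v (y + intVec m)) := by
    funext y
    refine tsum_eq_finsum ((hfin y).subset fun m hm => ⟨y, Metric.mem_ball_self one_pos, hm⟩)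
  rw [h]
  refine continuous_finsum hcont fun y0 => ⟨_, Metric.ball_mem_nhds y0 one_pos, ?_⟩
  refine (hfin y0).subset ?_
  rintro m ⟨y, hm, hy⟩
  exact ⟨y, hy, hm⟩

theorem integral_sq_zeroExtWeakDeriv_le {s : ℕ} {α : Fin d → ℕ} (hα : multiLength α ≤ s)
    (f : (Fin d → ℝ) → ℝ) :
    ∫ x, zeroExtWeakDeriv α f x ^ 2 ≤ isoNormUnit s f ^ 2 := by
  have h : (fun x => zeroExtWeakDeriv α f x ^ 2) =
      (openUnitCube d).indicator fun x => weakDeriv (openUnitCube d) α f x ^ 2 := by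
    funext x
    by_cases hx : x ∈ openUnitCube d <;> simp [zeroExtWeakDeriv, hx]
  have hnn : ∀ β : Fin d → ℕ, 0 ≤ ∫ x in openUnitCube d, weakDeriv (openUnitCube d) β f x ^ 2 :=
    fun β => integral_nonneg fun x => sq_nonneg _
  rw [h, integral_indicator (isOpen_openUnitCube d).measurableSet, isoNormUnit, sobolevNorm,
    Real.sq_sqrt (Finset.sum_nonneg fun β _ => hnn β)]
  exact Finset.single_le_sum
    (f := fun β => ∫ x in openUnitCube d, weakDeriv (openUnitCube d) β f x ^ 2)
    (fun β _ => hnn β) ((mem_multiIndices α).2 hα)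

/-- The integration error of a shifted lattice rule on `H̊^s`. -/
theorem MemIsoSobolevZero.abs_quadRule_sub_integral_le {s : ℕ} (hd : 1 ≤ d) (hs : d < 2 * s)
    (hS : IsUnit S.det) {r κ : ℝ} (hr0 : 0 ≤ r)
    (hr : ∀ x ∈ Set.Icc (fun _ : Fin d => (0 : ℝ)) (fun _ => 1), ∀ j,
      |S.transpose.mulVec x j| ≤ r)
    (hκ : 0 < κ) (hSκ : ∀ x, κ * ‖x‖ ≤ ‖S.mulVec x‖) (v : Fin d → ℝ) {f : (Fin d → ℝ) → ℝ}
    (hf : MemIsoSobolevZero s f) :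
    |quadRule S v f - ∫ x, f x| ≤ κ⁻¹ ^ s * √(∑' k : Fin d → ℤ, ‖intVec k‖⁻¹ ^ (2 * s)) *
      √(d * (2 * r + 2) ^ d / |S.det|) * isoNormUnit s f := by
  set N := isoNormUnit s f
  have hN : 0 ≤ N := Real.sqrt_nonneg _
  have hD : 0 < |S.det| := abs_pos.2 hS.ne_zero
  set D := |S.det|
  set K := Set.Icc (fun _ : Fin d => (0 : ℝ)) (fun _ => 1)
  obtain ⟨M, hMcard, hM⟩ := exists_finset_card_le_of_nodeMap_mem hS hr0 hr v
  have hfsupp : ∀ x, (f x : ℂ) ≠ 0 → x ∈ K := fun x hx =>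
    hf.support_subset (subset_tsupport f (by simpa using hx))
  let g : Fin d → (Fin d → ℝ) → ℝ := fun j => zeroExtWeakDeriv (Pi.single j s) f
  have hgsupp : ∀ j x, (g j x : ℂ) ≠ 0 → x ∈ K := fun j x hx =>
    openUnitCube_subset_Icc d (Set.mem_of_indicator_ne_zero (Complex.ofReal_ne_zero.1 hx))
  let a : (Fin d → ℤ) → ℂ := fun k => ∫ y, latticeChar (-k) y * (f (nodeMap S v y) : ℂ)
  let b : Fin d → (Fin d → ℤ) → ℂ := fun j k =>
    ∫ y, latticeChar (-k) y * (g j (nodeMap S v y) : ℂ)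
  have hbessel : ∀ j, (Summable fun k => ‖b j k‖ ^ 2) ∧
      ∑' k, ‖b j k‖ ^ 2 ≤ (2 * r + 2) ^ d * (D * N ^ 2) := by
    intro j
    have hl : multiLength (Pi.single j s : Fin d → ℕ) ≤ s := (multiLength_single j s).le
    have h1 : MemLp (fun x => (g j x : ℂ)) 1 :=
      memLp_one_iff_integrable.2 (integrable_zeroExtWeakDeriv hf hl).ofReal
    have h2 : MemLp (fun x => (g j x : ℂ)) 2 := (hf.zeroExtWeakDeriv_spec hl).1.ofReal
    have h := summable_tsum_sq_integral_latticeChar_le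
      (memLp_one_iff_integrable.1 (h1.comp_nodeMap hS v)) (h2.comp_nodeMap hS v) M
      fun m y hy hne => hM m y hy (hgsupp j _ hne)
    refine ⟨h.1, h.2.trans ?_⟩
    rw [integral_comp_nodeMap hS v fun x => ‖(g j x : ℂ)‖ ^ 2, smul_eq_mul]
    have h3 : ∫ x, ‖(g j x : ℂ)‖ ^ 2 ≤ N ^ 2 := by
      simp only [Complex.norm_real, Real.norm_eq_abs, sq_abs]
      exact integral_sq_zeroExtWeakDeriv_le hl f
    gcongr
  have hab : ∀ k, (κ * ‖intVec k‖) ^ (2 * s) * ‖a k‖ ^ 2 ≤ ∑ j, ‖b j k‖ ^ 2 := by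
    intro k
    have : Nonempty (Fin d) := ⟨⟨0, hd⟩⟩
    -- The coordinate attaining the sup norm of `Sk`: its pure derivative controls the coefficient,
    -- so no mixed derivatives are needed. Summing over all `j` afterwards removes the dependence of
    -- `j` on `k`.
    obtain ⟨j, hj⟩ : ∃ j, ‖S.mulVec (intVec k)‖ = ‖S.mulVec (intVec k) j‖ := by
      obtain ⟨j, hj⟩ := Finite.exists_max fun j => ‖S.mulVec (intVec k) j‖
      exact ⟨j, le_antisymm ((pi_norm_le_iff_of_nonneg (norm_nonneg _)).2 hj) (norm_le_pi_norm _ j)⟩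
    have h1 : ‖b j k‖ = |2 * Real.pi * S.mulVec (intVec k) j| ^ s * ‖a k‖ := by
      have h := hf.abs_pow_mul_norm_integral_exp j ((-(2 * Real.pi)) • S.mulVec (intVec k))
      simp only [b, a, norm_integral_latticeChar_mul_comp_nodeMap hS v k, g, ← h, Pi.smul_apply,
        smul_eq_mul, neg_mul, abs_neg]
      ring
    have h2 : κ * ‖intVec k‖ ≤ |2 * Real.pi * S.mulVec (intVec k) j| := by
      refine (hSκ _).trans (hj.trans_le ?_)
      rw [abs_mul, Real.norm_eq_abs]
      refine le_mul_of_one_le_left (abs_nonneg _) ?_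
      rw [abs_of_pos Real.two_pi_pos]
      linarith [Real.pi_gt_three]
    calc (κ * ‖intVec k‖) ^ (2 * s) * ‖a k‖ ^ 2 = ((κ * ‖intVec k‖) ^ s * ‖a k‖) ^ 2 := by ring
      _ ≤ ‖b j k‖ ^ 2 := by
        rw [h1]
        gcongr
      _ ≤ ∑ j, ‖b j k‖ ^ 2 :=
        Finset.single_le_sum (f := fun j => ‖b j k‖ ^ 2) (fun i _ => sq_nonneg _)
          (Finset.mem_univ j)
  set C := d * ((2 * r + 2) ^ d * (D * N ^ 2))
  have hbsum : Summable fun k => ∑ j, ‖b j k‖ ^ 2 := summable_sum fun j _ => (hbessel j).1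
  have hbtsum : ∑' k, ∑ j, ‖b j k‖ ^ 2 ≤ C := by
    rw [Summable.tsum_finsetSum fun j _ => (hbessel j).1]
    refine (Finset.sum_le_sum fun j _ => (hbessel j).2).trans ?_
    simp [C]
  -- The two Cauchy–Schwarz factors of `‖a k‖`. At `k = 0` both vanish as `s > 0`, so the product
  -- drops precisely the term that is the integral.
  let p : (Fin d → ℤ) → ℝ := fun k => ‖intVec k‖⁻¹ ^ s
  let q : (Fin d → ℤ) → ℝ := fun k => ‖intVec k‖ ^ s * ‖a k‖
  have hp2 : (fun k => p k ^ 2) = fun k => ‖intVec k‖⁻¹ ^ (2 * s) := by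
    funext k
    simp only [p]
    ring
  have hq2 : ∀ k, q k ^ 2 ≤ κ⁻¹ ^ (2 * s) * ∑ j, ‖b j k‖ ^ 2 := by
    intro k
    have h : q k ^ 2 = κ⁻¹ ^ (2 * s) * ((κ * ‖intVec k‖) ^ (2 * s) * ‖a k‖ ^ 2) := by
      rw [← mul_assoc, ← mul_pow, inv_mul_cancel_left₀ hκ.ne']
      ring
    rw [h]
    have := hab k
    gcongr
  have hq2s : Summable fun k => q k ^ 2 :=
    Summable.of_nonneg_of_le (fun k => sq_nonneg _) hq2 (hbsum.mul_left _)
  have hq2t : ∑' k, q k ^ 2 ≤ κ⁻¹ ^ (2 * s) * C := by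
    refine (hq2s.tsum_le_tsum hq2 (hbsum.mul_left _)).trans ?_
    rw [tsum_mul_left]
    gcongr
  have hp2s : Summable fun k => p k ^ 2 := by
    rw [hp2]
    exact summable_norm_intVec_inv_pow hs
  obtain ⟨hpqs, hpqt⟩ := Real.summable_mul_and_tsum_mul_le_sqrt_mul_sqrt
    (fun k => by positivity) (fun k => by positivity) hp2s hq2s
  have hpq : ∀ k, k ≠ 0 → p k * q k = ‖a k‖ := by
    intro k hk
    have : ‖intVec k‖ ≠ 0 := by
      rw [norm_ne_zero_iff]
      contrapose! hk
      funext i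
      exact Int.cast_eq_zero (α := ℝ).1 (congrFun hk i)
    simp only [p, q]
    rw [← mul_assoc, ← mul_pow, inv_mul_cancel₀ this, one_pow, one_mul]
  have hasum : Summable a := by
    -- The comparison is needed only off the finite set `{0}`.
    refine Summable.of_norm_bounded_eventually hpqs ?_
    filter_upwards [(Set.finite_singleton (0 : Fin d → ℤ)).compl_mem_cofinite] with k hk
    exact (hpq k hk).ge
  let P : (Fin d → ℝ) → ℂ := fun y => ∑' m : Fin d → ℤ, (f (nodeMap S v (y + intVec m)) : ℂ)
  have hPa : ∀ k, ∫ y in unitBox d, latticeChar (-k) y * P y = a k := by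
    intro k
    have h1 : MemLp (fun x => (f x : ℂ)) 1 := memLp_one_iff_integrable.2 hf.integrable.ofReal
    refine Eq.trans ?_ (integral_latticeChar_mul_sum
      (memLp_one_iff_integrable.1 (h1.comp_nodeMap hS v)) M
      (fun m y hy hne => hM m y hy (hfsupp _ hne)) (-k))
    refine setIntegral_congr_fun (measurableSet_unitBox d) fun y hy => ?_
    simp only [P]
    rw [tsum_eq_sum]
    intro m hm
    by_contra hne
    exact hm (hM m y hy (hfsupp _ hne))
  have hP0 : HasSum a (P 0) := by
    have h := hasSum_integral_latticeChar (P := P)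
      (continuous_tsum_comp_nodeMap hS hr v (Complex.continuous_ofReal.comp hf.continuous) hfsupp)
      (fun m y => by
        simp only [P]
        rw [← (Equiv.addLeft m).tsum_eq fun m' : Fin d → ℤ =>
          (f (nodeMap S v (y + intVec m')) : ℂ)]
        refine tsum_congr fun m' => ?_
        have : y + intVec m + intVec m' = y + intVec (m + m') := by
          funext i
          simp [intVec, add_assoc]
        rw [this, Equiv.coe_addLeft])
    simp only [hPa] at h
    exact h hasum
  have ha0 : a 0 = (D * ∫ x, f x : ℝ) := by
    simp only [a, neg_zero, latticeChar_zero, one_mul]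
    rw [integral_complex_ofReal, integral_comp_nodeMap hS v f, smul_eq_mul]
  have hQ : P 0 = (D * quadRule S v f : ℝ) := by
    simp only [P, quadRule]
    rw [← mul_assoc, mul_one_div_cancel hD.ne', one_mul, Complex.ofReal_tsum]
    simp only [nodeMap, zero_add]
  have herr : ‖P 0 - a 0‖ ≤ √(∑' k, p k ^ 2) * √(∑' k, q k ^ 2) := by
    refine le_trans ?_ hpqt
    have h1 := hP0.sub (hasSum_ite_eq (0 : Fin d → ℤ) (a 0))
    rw [← h1.tsum_eq]
    refine tsum_of_norm_bounded hpqs.hasSum fun k => ?_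
    by_cases hk : k = 0
    · subst hk
      simp only [if_true, sub_self, norm_zero]
      positivity
    · simp only [if_neg hk, sub_zero]
      exact (hpq k hk).ge
  rw [hQ, ha0, ← Complex.ofReal_sub, Complex.norm_real, Real.norm_eq_abs, ← mul_sub, abs_mul,
    abs_of_pos hD, hp2] at herr
  have hC : √(κ⁻¹ ^ (2 * s) * C) = D * (κ⁻¹ ^ s * √(d * (2 * r + 2) ^ d / D) * N) := by
    have hr2 : 0 ≤ d * (2 * r + 2) ^ d / D := by positivity
    have hDD : D * D / D = D := mul_self_div_self D
    rw [Real.sqrt_eq_iff_eq_sq (by positivity) (by positivity), mul_pow, mul_pow, mul_pow,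
      Real.sq_sqrt hr2]
    simp only [C]
    field_simp
    ring
  have hfin := herr.trans (mul_le_mul_of_nonneg_left (Real.sqrt_le_sqrt hq2t) (Real.sqrt_nonneg _))
  rw [hC] at hfin
  refine le_of_mul_le_mul_left (hfin.trans_eq ?_) hD
  ring

end LatticeRule

/-! ### How determinant, row sums and lower norm bound scale under dilation. -/

section DilatedMatrix

/-- `κ` is the reciprocal of the operator norm of `B⁻¹`, with one added to avoid division by zero.
-/
theorem exists_pos_mul_norm_le_norm_mulVec {d : ℕ} {B : Matrix (Fin d) (Fin d) ℝ}
    (hB : IsUnit B.det) : ∃ κ : ℝ, 0 < κ ∧ ∀ x, κ * ‖x‖ ≤ ‖B.mulVec x‖ := by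
  let L : (Fin d → ℝ) →L[ℝ] (Fin d → ℝ) := LinearMap.toContinuousLinearMap (B⁻¹).mulVecLin
  refine ⟨(‖L‖ + 1)⁻¹, by positivity, fun x => ?_⟩
  rw [inv_mul_le_iff₀ (by positivity)]
  have h : L (B.mulVec x) = x := by
    change (B⁻¹).mulVec (B.mulVec x) = x
    rw [Matrix.mulVec_mulVec, Matrix.nonsing_inv_mul _ hB, Matrix.one_mulVec]
  calc ‖x‖ = ‖L (B.mulVec x)‖ := by rw [h]
    _ ≤ ‖L‖ * ‖B.mulVec x‖ := L.le_opNorm _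
    _ ≤ (‖L‖ + 1) * ‖B.mulVec x‖ := by gcongr; linarith

variable {d n : ℕ} {u : Fin d → ℝ} (B : Matrix (Fin d) (Fin d) ℝ)

theorem det_dilatedMatrix (hd : 1 ≤ d) :
    (dilatedMatrix n u B).det = n * ((∏ j, u j) * B.det) := by
  rw [dilatedMatrix, Matrix.det_smul, Matrix.det_mul, Matrix.det_diagonal, Fintype.card_fin,
    one_div, Real.rpow_inv_natCast_pow (Nat.cast_nonneg n) (by omega)]

theorem natCast_mul_abs_det_le_abs_det_dilatedMatrix (hd : 1 ≤ d) (hu : ∀ j, 1 ≤ u j) :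
    n * |B.det| ≤ |(dilatedMatrix n u B).det| := by
  have h : 1 ≤ ∏ j, u j := Finset.one_le_prod fun j _ => hu j
  rw [det_dilatedMatrix B hd, abs_mul, abs_mul, Nat.abs_cast, abs_of_nonneg (zero_le_one.trans h)]
  gcongr
  exact le_mul_of_one_le_left (abs_nonneg _) h

theorem dilatedMatrix_apply (i j : Fin d) :
    dilatedMatrix n u B i j = (n : ℝ) ^ (1 / (d : ℝ)) * (u i * B i j) := by
  rw [dilatedMatrix, Matrix.smul_apply, Matrix.diagonal_mul, smul_eq_mul]

theorem abs_transpose_dilatedMatrix_mulVec_le (hu : ∀ j, 1 ≤ u j ∧ u j ≤ 2) {x : Fin d → ℝ}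
    (hx : x ∈ Set.Icc (fun _ : Fin d => (0 : ℝ)) (fun _ => 1)) (j : Fin d) :
    |(dilatedMatrix n u B).transpose.mulVec x j| ≤
      (n : ℝ) ^ (1 / (d : ℝ)) * (2 * ∑ j, ∑ i, |B i j|) := by
  have h1 : ∑ i, |B i j| ≤ ∑ j, ∑ i, |B i j| :=
    Finset.single_le_sum (f := fun j => ∑ i, |B i j|)
      (fun j _ => Finset.sum_nonneg fun i _ => abs_nonneg _) (Finset.mem_univ j)
  calc |(dilatedMatrix n u B).transpose.mulVec x j|
      = |∑ i, (n : ℝ) ^ (1 / (d : ℝ)) * (u i * B i j) * x i| := by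
        simp only [Matrix.mulVec, dotProduct, Matrix.transpose_apply, dilatedMatrix_apply]
    _ ≤ ∑ i, |(n : ℝ) ^ (1 / (d : ℝ)) * (u i * B i j) * x i| := Finset.abs_sum_le_sum_abs _ _
    _ ≤ ∑ i, (n : ℝ) ^ (1 / (d : ℝ)) * (2 * |B i j|) * 1 := by
        refine Finset.sum_le_sum fun i _ => ?_
        have h2 : 0 ≤ u i := zero_le_one.trans (hu i).1
        have hx0 : 0 ≤ x i := hx.1 i
        have hx1 : x i ≤ 1 := hx.2 i
        rw [abs_mul, abs_mul, abs_mul, abs_of_nonneg h2, abs_of_nonneg hx0,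
          abs_of_nonneg (by positivity : (0 : ℝ) ≤ (n : ℝ) ^ (1 / (d : ℝ)))]
        gcongr
        exact (hu i).2
    _ = (n : ℝ) ^ (1 / (d : ℝ)) * (2 * ∑ i, |B i j|) := by
        simp only [mul_one, ← Finset.mul_sum]
    _ ≤ _ := by gcongr

theorem mul_norm_mulVec_le_norm_dilatedMatrix_mulVec (hu : ∀ j, 1 ≤ u j) (x : Fin d → ℝ) :
    (n : ℝ) ^ (1 / (d : ℝ)) * ‖B.mulVec x‖ ≤ ‖(dilatedMatrix n u B).mulVec x‖ := by
  rw [dilatedMatrix, Matrix.smul_mulVec, norm_smul, Real.norm_of_nonneg (by positivity),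
    ← Matrix.mulVec_mulVec]
  gcongr
  refine (pi_norm_le_iff_of_nonneg (norm_nonneg _)).2 fun i => ?_
  refine le_trans ?_ (norm_le_pi_norm _ i)
  rw [Matrix.mulVec_diagonal, norm_mul, Real.norm_of_nonneg (zero_le_one.trans (hu i))]
  exact le_mul_of_one_le_left (norm_nonneg _) (hu i)

theorem bounds_of_mem_dilationBox (hd : 1 ≤ d) (hu : u ∈ dilationBox d) (j : Fin d) :
    1 ≤ u j ∧ u j ≤ 2 := by
  refine ⟨hu.1 j, (hu.2 j).trans ?_⟩
  have hd' : (1 : ℝ) ≤ d := by exact_mod_cast hd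
  calc (2 : ℝ) ^ (1 / (d : ℝ)) ≤ 2 ^ (1 : ℝ) :=
        Real.rpow_le_rpow_of_exponent_le one_le_two ((div_le_one (by linarith)).2 hd')
    _ = 2 := Real.rpow_one 2

end DilatedMatrix

/-! ### Uniform error bound over the dilation box. -/

theorem mainTheorem5 (d s : ℕ) (hd : 1 ≤ d) (hs : (d : ℝ) / 2 < (s : ℝ))
    (B : Matrix (Fin d) (Fin d) ℝ) (hB : IsFrolovMatrix B) :
    ∃ c : ℝ, 0 < c ∧ ∀ (v : Fin d → ℝ) (n : ℕ), 1 ≤ n →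
      ∀ f : (Fin d → ℝ) → ℝ, MemIsoSobolevZero s f →
        BddAbove (quadError B n v f '' dilationBox d) ∧
        sSup (quadError B n v f '' dilationBox d)
          ≤ c * (n : ℝ) ^ (-((s : ℝ) / (d : ℝ))) * isoNormUnit s f := by
  obtain ⟨κ, hκ, hBκ⟩ := exists_pos_mul_norm_le_norm_mulVec hB.invertible
  have hs' : d < 2 * s := by
    rw [div_lt_iff₀ two_pos] at hs
    have : (d : ℝ) < (2 * s : ℕ) := by push_cast; linarith
    exact_mod_cast this
  set β : ℝ := 2 * ∑ j, ∑ i, |B i j|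
  have hβ : 0 ≤ β := by positivity
  have hdet : 0 < |B.det| := abs_pos.2 hB.invertible.ne_zero
  set Z : ℝ := √(∑' k : Fin d → ℤ, ‖intVec k‖⁻¹ ^ (2 * s))
  have hZ : 0 ≤ Z := Real.sqrt_nonneg _
  set c : ℝ := κ⁻¹ ^ s * Z * √(d * (2 * β + 2) ^ d / |B.det|)
  -- Only `0 ≤ c` is at hand; adding one makes the constant positive.
  refine ⟨c + 1, by positivity, fun v n hn f hf => ?_⟩
  have hN : 0 ≤ isoNormUnit s f := Real.sqrt_nonneg _
  have hn0 : (0 : ℝ) < n := by exact_mod_cast hn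
  set t : ℝ := (n : ℝ) ^ (1 / (d : ℝ))
  have ht0 : 0 < t := Real.rpow_pos_of_pos hn0 _
  have ht1 : 1 ≤ t := Real.one_le_rpow (by exact_mod_cast hn) (by positivity)
  have htd : t ^ d = n := by
    simp only [t]
    rw [one_div, Real.rpow_inv_natCast_pow hn0.le (by omega)]
  have hts : t⁻¹ ^ s = (n : ℝ) ^ (-((s : ℝ) / (d : ℝ))) := by
    rw [Real.rpow_neg hn0.le, inv_pow, ← Real.rpow_natCast, ← Real.rpow_mul hn0.le]
    congr 2
    ring
  have key : ∀ u ∈ dilationBox d, quadError B n v f u ≤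
      (c + 1) * (n : ℝ) ^ (-((s : ℝ) / (d : ℝ))) * isoNormUnit s f := by
    intro u hu
    have hu2 := bounds_of_mem_dilationBox hd hu
    have hu1 := fun j => (hu2 j).1
    have hD := natCast_mul_abs_det_le_abs_det_dilatedMatrix (n := n) B hd hu1
    have hD0 : 0 < |(dilatedMatrix n u B).det| := (mul_pos hn0 hdet).trans_le hD
    have h := hf.abs_quadRule_sub_integral_le hd hs' (S := dilatedMatrix n u B) (r := t * β)
      (κ := t * κ) (isUnit_iff_ne_zero.2 (abs_pos.1 hD0)) (by positivity)
      (fun x hx j => abs_transpose_dilatedMatrix_mulVec_le B hu2 hx j) (by positivity)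
      (fun x => by
        refine le_trans ?_ (mul_norm_mulVec_le_norm_dilatedMatrix_mulVec B hu1 x)
        rw [mul_assoc]
        exact mul_le_mul_of_nonneg_left (hBκ x) ht0.le) v
    refine h.trans ?_
    -- Since `t ≥ 1`, `2tβ + 2 ≤ t(2β + 2)`. The resulting `t^d = n` cancels the `n` in the lower
    -- bound for the determinant, leaving a bound independent of `n` and `u`.
    have hratio : d * (2 * (t * β) + 2) ^ d / |(dilatedMatrix n u B).det| ≤
        d * (2 * β + 2) ^ d / |B.det| := by
      calc d * (2 * (t * β) + 2) ^ d / |(dilatedMatrix n u B).det|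
          ≤ d * (t * (2 * β + 2)) ^ d / (n * |B.det|) := by
            gcongr
            linarith
        _ = d * (2 * β + 2) ^ d / |B.det| := by
            rw [mul_pow, htd]
            field_simp
    have hsqrt := Real.sqrt_le_sqrt hratio
    calc (t * κ)⁻¹ ^ s * Z * √(d * (2 * (t * β) + 2) ^ d / |(dilatedMatrix n u B).det|) *
          isoNormUnit s f
        ≤ (t * κ)⁻¹ ^ s * Z * √(d * (2 * β + 2) ^ d / |B.det|) * isoNormUnit s f := by gcongr
      _ = c * t⁻¹ ^ s * isoNormUnit s f := by
          rw [mul_inv, mul_pow]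
          ring
      _ ≤ (c + 1) * t⁻¹ ^ s * isoNormUnit s f := by
          gcongr
          linarith
      _ = _ := by rw [hts]
  refine ⟨⟨_, Set.forall_mem_image.2 key⟩, Real.sSup_le (Set.forall_mem_image.2 key) (by positivity)⟩
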